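/- Let $(\mathbb K,|\cdot|)$ be an algebraically closed normed field, let $f\in\mathbb K[z]$ be a polynomial of degree $n\ge 2$ with leading coefficient $a_0$, let $N\ge 1$ be an integer, and let $1\le p,q\le\infty$ with $1/p+1/q=1$ (where $1/\infty=0$). Put $a=(n-1)^{1/q}$. For $x\in\mathbb K^n$ with distinct components define, for $i=1,\dots,n$, $$W_i(x)=\frac{f(x_i)}{a_0\prod_{j\ne i}(x_i-x_j)},\qquad d_i(x)=\min_{j\ne i}|x_i-x_j|,\qquad E_f(x)=\Big\|\Big(\frac{|W_1(x)|}{d_1(x)},\dots,\frac{|W_n(x)|}{d_n(x)}\Big)\Big\|_p ,$$ and define the real functions $$\Psi(t)=(1+2t)\Big(1+\frac{t}{(n-1)^{1/p}}\Big)^{n-1},\quad \alpha(t)=\frac{2}{1-(a-1)t+\sqrt{(1-(a-1)t)^2-4t}},\quad h(t)=t\,\alpha(t),\quad \Omega(t)=\Psi(h(t)).$$ Define maps $T^{(m)}:D_m\subset\mathbb K^n\to\mathbb K^n$ recursively by $D_0=\mathbb K^n$, $T^{(0)}(x)=x$, $$D_{m+1}=\{x\in D_m:\ x_i\ne T^{(m)}_j(x)\text{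 for all } i\ne j\},\qquad T^{(m+1)}_i(x)=x_i-\frac{f(x_i)}{a_0\prod_{j\ne i}\big(x_i-T^{(m)}_j(x)\big)}\quad(i=1,\dots,n).$$ A vector $\xi\in\mathbb K^n$ is called a root-vector of $f$ if $f(z)=a_0\prod_{i=1}^n(z-\xi_i)$ for all $z\in\mathbb K$. **Theorem.** Suppose $x^{(0)}\in\mathbb K^n$ has distinct components and satisfies $$E_f(x^{(0)})\le\frac1{(1+\sqrt a)^2}\qquad\text{and}\qquad \Omega(E_f(x^{(0)}))<2,$$ where in the case $n=2$, $p=\infty$ the first inequality is assumed to be strict. Then $f$ has only simple zeros in $\mathbb K$; the iteration $x^{(k+1)}=T^{(N)}(x^{(k)})$, $k=0,1,2,\dots$, is well defined (that is, $x^{(k)}\in D_N$ for all $k\ge0$) and every $x^{(k)}$ has distinct components; and there is a root-vector $\xi$ of $f$ such that $x^{(k)}\to\xi$ with order of convergence $N+1$, i.e. there is a constant $C$ with $$\|x^{(k+1)}-\xi\|_p\le C\,\|x^{(k)}-\xi\|_p^{\,N+1}\qquad\text{for all }k\ge0,$$ and such that $$|x^{(k)}_i-\xi_i|\le\alpha\big(E_f(x^{(k)})\big)\,|W_i(x^{(k)})|\qquad(i=1,\dots,n)$$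 for every $k\ge0$ for which $E_f(x^{(k)})\le 1/(1+\sqrt a)^2$ and $\Omega(E_f(x^{(k)}))<2$. -/

import Mathlib

open Polynomial Filter Topology
open scoped ENNReal

namespace WeierstrassType

/-- The `p`-norm of a vector, `(∑ |v i| ^ p) ^ (1 / p)` for finite `p` and `max |v i|` for `p = ∞`. -/
noncomputable def pNorm {E : Type*} [NormedField E] {n : ℕ} (p : ℝ≥0∞) (v : Fin n → E) : ℝ :=
  ‖(WithLp.toLp p v : PiLp p (fun _ : Fin n => E))‖

section Field

variable {K : Type*} [NormedField K] {n : ℕ}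

/-- `ξ` is a root-vector of `f`: `f(z) = a₀ ∏ (z - ξ i)` for all `z`, for some constant `a₀`. -/
def IsRootVector (f : K[X]) (ξ : Fin n → K) : Prop :=
  ∃ a₀ : K, ∀ z : K, f.eval z = a₀ * ∏ i, (z - ξ i)

/-- Every zero of `f` has multiplicity one. -/
def HasOnlySimpleZeros (f : K[X]) : Prop :=
  ∀ z : K, f.IsRoot z → f.rootMultiplicity z = 1

/-- The distance from `x i` to the nearest other component, `min_{j ≠ i} |x i - x j|`. -/
noncomputable def sep (x : Fin n → K) (i : Fin n) : ℝ :=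
  ⨅ j : {j : Fin n // j ≠ i}, ‖x i - x j‖

/-- The Weierstrass correction `W_f(x)`, meaningful for `x` with distinct components. -/
noncomputable def W (f : K[X]) (x : Fin n → K) (i : Fin n) : K :=
  f.eval (x i) / (f.leadingCoeff * ∏ j ∈ Finset.univ.erase i, (x i - x j))

/-- `E_f(x) = ‖W_f(x) / d(x)‖_p`, with `W_f(x) / d(x)` the vector of the `|W_i(x)| / d_i(x)`. -/
noncomputable def initFun (p : ℝ≥0∞) (f : K[X]) (x : Fin n → K) : ℝ :=
  pNorm p (fun i => ‖W f x i‖ / sep x i)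

/-- The relation `x # y`: `x i ≠ y j` whenever `i ≠ j`. -/
def Sharp (x y : Fin n → K) : Prop :=
  ∀ i j : Fin n, i ≠ j → x i ≠ y j

/-- The iteration functions `T^(N)`; their values are meaningful on the domain `iterDomain f N`. -/
noncomputable def iterMap (f : K[X]) : ℕ → (Fin n → K) → (Fin n → K)
  | 0, x => x
  | N + 1, x => fun i =>
      x i - f.eval (x i) /
        (f.leadingCoeff * ∏ j ∈ Finset.univ.erase i, (x i - iterMap f N x j))

/-- The domain `D_N` of `T^(N)`. -/
def iterDomain (f : K[X]) : ℕ → Set (Fin n → K)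
  | 0 => Set.univ
  | N + 1 => {x | x ∈ iterDomain f N ∧ Sharp x (iterMap f N x)}

/-- The sequence `x` converges to `ξ` with order of convergence (at least) `r`: it converges and
`‖x (k + 1) - ξ‖ ≤ C ‖x k - ξ‖ ^ r` for all `k`, with a constant `C` independent of `k`. -/
def ConvergesWithOrder (p : ℝ≥0∞) (x : ℕ → Fin n → K) (ξ : Fin n → K) (r : ℕ) : Prop :=
  Tendsto x atTop (𝓝 ξ) ∧
    ∃ C : ℝ, ∀ k : ℕ, pNorm p (x (k + 1) - ξ) ≤ C * pNorm p (x k - ξ) ^ r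

end Field

/-- `a = (n - 1) ^ (1 / q)`, where `1 / ∞ = 0`. -/
noncomputable def aConst (n : ℕ) (q : ℝ≥0∞) : ℝ :=
  ((n : ℝ) - 1) ^ (1 / q).toReal

/-- `Ψ(t) = (1 + 2 t) (1 + t / (n - 1) ^ (1 / p)) ^ (n - 1)`, where `1 / ∞ = 0`. -/
noncomputable def Psi (n : ℕ) (p : ℝ≥0∞) (t : ℝ) : ℝ :=
  (1 + 2 * t) * (1 + t / ((n : ℝ) - 1) ^ (1 / p).toReal) ^ (n - 1)

/-- `α(t) = 2 / (1 - (a - 1) t + √((1 - (a - 1) t)² - 4 t))`. -/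
noncomputable def alpha (a t : ℝ) : ℝ :=
  2 / (1 - (a - 1) * t + Real.sqrt ((1 - (a - 1) * t) ^ 2 - 4 * t))

/-- `h(t) = t α(t)`. -/
noncomputable def hFun (a t : ℝ) : ℝ :=
  t * alpha a t

/-- `Ω(t) = Ψ(h(t))`. -/
noncomputable def Omega (n : ℕ) (p q : ℝ≥0∞) (t : ℝ) : ℝ :=
  Psi n p (hFun (aConst n q) t)

end WeierstrassType

/-! Put `t = E_f(x)`, `h = t * α(t)` and let `S_i(z) = ∑_{j ≠ i} W_j / (z - x_j)`. Lagrange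
interpolation at the nodes `x_j` writes `f(z)` as `a₀ ∏_{j ≠ i} (z - x_j) * ((z - x_i) (1 + S_i(z))
+ W_i)`, so near `x_i` the zeros of `f` are the fixed points of `φ(z) = x_i - W_i / (1 + S_i(z))`.
The number `α` is the one for which the disc of radius `α |W_i|` about `x_i` is mapped into itself,
and `Ω(t) < 2` makes `φ` a contraction there. The field need not be complete: approximate fixed
points make `f` arbitrarily small on the disc, and splitting `f` into linear factors then forces a
zero in the disc (`exists_isRoot_norm_sub_le`). As `h < 1/2` these zeros are distinct, so they form
a root-vector `ξ` and are simple.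

The rest is a local analysis around `ξ` with radius `τ = h` in the scaled error `errFun`. The
condition `Ψ(τ) < 2` reads `(1 + 2τ)(1 + B) < 2`, where `B` is the contraction factor of one
Weierstrass correction. It gives both that errors shrink by `B` and that separations shrink by no
more than `B`, so the condition persists. Each inner correction gains one factor of the relative
error (`iterMap_succ_bound`), whence order `N + 1`. At a later `k` a disc again contains a zero,
which must be `ξ i` because all radii are below half the separations. -/

namespace WeierstrassType

/-! ### Hölder estimates for the `p`-norm. -/

section Norms

variable {E F : Type*} [NormedField E] [NormedField F] {n : ℕ} {p q : ℝ≥0∞}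

lemma norm_apply_le_pNorm (hp : 1 ≤ p) (v : Fin n → E) (i : Fin n) : ‖v i‖ ≤ pNorm p v := by
  have : Fact (1 ≤ p) := ⟨hp⟩
  exact PiLp.norm_apply_le (WithLp.toLp p v : PiLp p (fun _ : Fin n => E)) i

lemma pNorm_nonneg (hp : 1 ≤ p) (v : Fin n → E) : 0 ≤ pNorm p v := by
  have : Fact (1 ≤ p) := ⟨hp⟩
  exact norm_nonneg (WithLp.toLp p v : PiLp p (fun _ : Fin n => E))

lemma pNorm_eq_sum (hp : 1 ≤ p) (hp' : p ≠ ∞) (v : Fin n → E) :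
    pNorm p v = (∑ i, ‖v i‖ ^ p.toReal) ^ (1 / p.toReal) :=
  PiLp.norm_eq_sum (ENNReal.toReal_pos (zero_lt_one.trans_le hp).ne' hp') _

lemma pNorm_le_mul (hp : 1 ≤ p) {v : Fin n → E} {w : Fin n → F} {c : ℝ} (hc : 0 ≤ c)
    (h : ∀ i, ‖v i‖ ≤ c * ‖w i‖) : pNorm p v ≤ c * pNorm p w := by
  by_cases hp' : p = ∞
  · have h1 : pNorm p v = ⨆ i, ‖v i‖ := by
      subst hp'; exact PiLp.norm_eq_ciSup _
    rw [h1]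
    refine Real.iSup_le (fun i => (h i).trans ?_) (mul_nonneg hc (pNorm_nonneg hp w))
    gcongr
    exact norm_apply_le_pNorm hp w i
  · have hpos : 0 < p.toReal := ENNReal.toReal_pos (zero_lt_one.trans_le hp).ne' hp'
    have hs : 0 ≤ ∑ i, ‖w i‖ ^ p.toReal := Finset.sum_nonneg fun i _ => by positivity
    rw [pNorm_eq_sum hp hp', pNorm_eq_sum hp hp']
    calc (∑ i, ‖v i‖ ^ p.toReal) ^ (1 / p.toReal)
        ≤ (∑ i, (c * ‖w i‖) ^ p.toReal) ^ (1 / p.toReal) := by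
          gcongr with i _
          exact h i
      _ = (c ^ p.toReal * ∑ i, ‖w i‖ ^ p.toReal) ^ (1 / p.toReal) := by
          rw [Finset.mul_sum]
          congr 1
          exact Finset.sum_congr rfl fun i _ => Real.mul_rpow hc (norm_nonneg _)
      _ = c * (∑ i, ‖w i‖ ^ p.toReal) ^ (1 / p.toReal) := by
          rw [Real.mul_rpow (by positivity) hs, ← Real.rpow_mul hc,
            mul_one_div_cancel hpos.ne', Real.rpow_one]

lemma toReal_add_toReal_of_conj (hpq : 1 / p + 1 / q = 1) :
    (1 / p).toReal + (1 / q).toReal = 1 := by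
  have h1 : 1 / p ≠ ∞ := fun h => by simp [h] at hpq
  have h2 : 1 / q ≠ ∞ := fun h => by simp [h] at hpq
  rw [← ENNReal.toReal_add h1 h2, hpq, ENNReal.toReal_one]

/-- Hölder against the all-ones vector on the `n - 1` remaining indices, whose `q`-norm is `a`. -/
lemma sum_erase_norm_le (hp : 1 ≤ p) (hpq : 1 / p + 1 / q = 1) (v : Fin n → E) (i : Fin n) :
    ∑ j ∈ Finset.univ.erase i, ‖v j‖ ≤ aConst n q * pNorm p v := by
  have hn : 1 ≤ n := i.pos
  have hcard : ((Finset.univ.erase i).card : ℝ) = (n : ℝ) - 1 := by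
    rw [Finset.card_erase_of_mem (Finset.mem_univ i), Finset.card_univ, Fintype.card_fin,
      Nat.cast_sub hn, Nat.cast_one]
  have hconj := toReal_add_toReal_of_conj hpq
  by_cases hp' : p = ∞
  · have hq : (1 / q).toReal = 1 := by simpa [hp'] using hconj
    rw [aConst, hq, Real.rpow_one, ← hcard, ← nsmul_eq_mul]
    exact Finset.sum_le_card_nsmul _ _ _ fun j _ => norm_apply_le_pNorm hp v j
  · have hp1 : 1 ≤ p.toReal := by
      simpa using ENNReal.toReal_mono hp' hp
    have hq : (1 / q).toReal = 1 - p.toReal⁻¹ := by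
      rw [one_div, ENNReal.toReal_inv] at hconj
      linarith
    have := Real.inner_le_weight_mul_Lp_of_nonneg (Finset.univ.erase i) hp1 (fun _ => (1 : ℝ))
      (fun j => ‖v j‖) (fun _ => zero_le_one) (fun _ => norm_nonneg _)
    simp only [one_mul, Finset.sum_const, nsmul_eq_mul, mul_one, hcard] at this
    refine this.trans ?_
    rw [aConst, hq, pNorm_eq_sum hp hp', one_div]
    have h1 : (0 : ℝ) ≤ (n : ℝ) - 1 := by rw [← hcard]; positivity
    gcongr
    exact Finset.erase_subset _ _

lemma one_le_aConst (hn : 2 ≤ n) (q : ℝ≥0∞) : 1 ≤ aConst n q := by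
  have : (2 : ℝ) ≤ n := by exact_mod_cast hn
  exact Real.one_le_rpow (by linarith) ENNReal.toReal_nonneg

lemma div_rpow_eq_aConst_mul_div (hn : 2 ≤ n) (hpq : 1 / p + 1 / q = 1) (t : ℝ) :
    t / ((n : ℝ) - 1) ^ (1 / p).toReal = aConst n q * t / ((n - 1 : ℕ) : ℝ) := by
  have h2 : (2 : ℝ) ≤ n := by exact_mod_cast hn
  have h1 : 0 < (n : ℝ) - 1 := by linarith
  have h : aConst n q * ((n : ℝ) - 1) ^ (1 / p).toReal = (n : ℝ) - 1 := by
    rw [aConst, ← Real.rpow_add h1, add_comm, toReal_add_toReal_of_conj hpq, Real.rpow_one]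
  have h3 : 0 < ((n : ℝ) - 1) ^ (1 / p).toReal := Real.rpow_pos_of_pos h1 _
  rw [Nat.cast_sub (by omega), Nat.cast_one, div_eq_div_iff h3.ne' h1.ne']
  linear_combination (-t) * h

end Norms

/-! ### Bounds for perturbed products. -/

section RealInequalities

/-- The inequality of arithmetic and geometric means; it turns control of a sum into the power
appearing in `Psi`. -/
lemma prod_one_add_le_pow {ι : Type*} (s : Finset ι) (hs : s.Nonempty) (u : ι → ℝ)
    (hu : ∀ i ∈ s, 0 ≤ u i) :
    ∏ i ∈ s, (1 + u i) ≤ (1 + (∑ i ∈ s, u i) / s.card) ^ s.card := by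
  have hc : 0 < s.card := hs.card_pos
  have hc' : (0 : ℝ) < s.card := by exact_mod_cast hc
  have h := Real.geom_mean_le_arith_mean s (fun _ => 1) (fun i => 1 + u i)
    (fun _ _ => zero_le_one) (by simpa using hc) (fun i hi => by linarith [hu i hi])
  simp only [Real.rpow_one, Finset.sum_const, nsmul_eq_mul, mul_one, one_mul,
    Finset.sum_add_distrib] at h
  have h0 : 0 ≤ ∏ i ∈ s, (1 + u i) := Finset.prod_nonneg fun i hi => by linarith [hu i hi]
  calc ∏ i ∈ s, (1 + u i) = ((∏ i ∈ s, (1 + u i)) ^ ((s.card : ℝ)⁻¹)) ^ s.card := by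
        rw [← Real.rpow_natCast, ← Real.rpow_mul h0, inv_mul_cancel₀ hc'.ne', Real.rpow_one]
    _ ≤ _ := by
        gcongr
        refine h.trans_eq ?_
        rw [add_div, div_self hc'.ne']

lemma norm_prod_one_add_sub_one_le_prod {K ι : Type*} [NormedField K] (s : Finset ι) (u : ι → K) :
    ‖∏ i ∈ s, (1 + u i) - 1‖ ≤ ∏ i ∈ s, (1 + ‖u i‖) - 1 := by
  classical
  induction s using Finset.induction_on with
  | empty => simp
  | insert i s hi ih =>
    rw [Finset.prod_insert hi, Finset.prod_insert hi]
    have h1 : (1 + u i) * ∏ j ∈ s, (1 + u j) - 1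
        = (1 + u i) * (∏ j ∈ s, (1 + u j) - 1) + u i := by ring
    have h2 : ‖1 + u i‖ ≤ 1 + ‖u i‖ := (norm_add_le _ _).trans (by simp)
    calc ‖(1 + u i) * ∏ j ∈ s, (1 + u j) - 1‖
        ≤ ‖1 + u i‖ * ‖∏ j ∈ s, (1 + u j) - 1‖ + ‖u i‖ := by
          rw [h1, ← norm_mul]; exact norm_add_le _ _
      _ ≤ (1 + ‖u i‖) * (∏ j ∈ s, (1 + ‖u j‖) - 1) + ‖u i‖ := by gcongr
      _ = _ := by ring

/-- Convexity of the power between `1` and `1 + c`. Pulling out the factor `k` is what later raises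
the order of convergence. -/
lemma one_add_mul_pow_sub_one_le {k c : ℝ} (hk : 0 ≤ k) (hk' : k ≤ 1) (hc : 0 ≤ c) (m : ℕ) :
    (1 + k * c) ^ m - 1 ≤ k * ((1 + c) ^ m - 1) := by
  have := (convexOn_pow m).2 (Set.mem_Ici.2 zero_le_one)
    (Set.mem_Ici.2 (by linarith : (0 : ℝ) ≤ 1 + c)) (sub_nonneg.2 hk') hk (by ring)
  simp only [smul_eq_mul, one_pow, mul_one] at this
  have h : 1 + k * c = 1 - k + k * (1 + c) := by ring
  rw [h]
  linarith

end RealInequalities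

/-! ### Separation of the components. -/

section Sep

variable {K : Type*} [NormedField K] {n : ℕ}

lemma sep_le (x : Fin n → K) {i j : Fin n} (h : j ≠ i) : sep x i ≤ ‖x i - x j‖ :=
  ciInf_le (f := fun j : {j : Fin n // j ≠ i} => ‖x i - x j‖) (Set.finite_range _).bddBelow ⟨j, h⟩

lemma nonempty_ne (hn : 2 ≤ n) (i : Fin n) : Nonempty {j : Fin n // j ≠ i} := by
  have : Nontrivial (Fin n) := Fin.nontrivial_iff_two_le.2 hn
  obtain ⟨j, hj⟩ := exists_ne i
  exact ⟨⟨j, hj⟩⟩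

lemma le_sep (hn : 2 ≤ n) {x : Fin n → K} {i : Fin n} {c : ℝ}
    (h : ∀ j, j ≠ i → c ≤ ‖x i - x j‖) : c ≤ sep x i :=
  have := nonempty_ne hn i
  le_ciInf fun j => h j j.2

lemma sep_pos (hn : 2 ≤ n) {x : Fin n → K} (hx : Function.Injective x) (i : Fin n) :
    0 < sep x i := by
  have := nonempty_ne hn i
  obtain ⟨j, hj⟩ := exists_eq_ciInf_of_finite (f := fun j : {j : Fin n // j ≠ i} => ‖x i - x j‖)
  rw [sep, ← hj]
  exact norm_pos_iff.2 (sub_ne_zero.2 fun h => j.2 (hx h.symm))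

lemma sep_nonneg (x : Fin n → K) (i : Fin n) : 0 ≤ sep x i :=
  Real.iInf_nonneg fun _ => norm_nonneg _

end Sep

/-! ### Lagrange interpolation and the Weierstrass corrections. -/

section Interpolation

variable {K : Type*} [NormedField K] {n : ℕ}

lemma degree_prod_X_sub_C {ι : Type*} (s : Finset ι) (x : ι → K) :
    (∏ j ∈ s, (X - C (x j))).degree = (s.card : WithBot ℕ) := by
  rw [degree_prod]
  simp

lemma eval_prod_X_sub_C {ι : Type*} (s : Finset ι) (x : ι → K) (z : K) :
    (∏ j ∈ s, (X - C (x j))).eval z = ∏ j ∈ s, (z - x j) := by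
  rw [eval_prod]
  simp

lemma prod_erase_sub_ne_zero {x : Fin n → K} (hx : Function.Injective x) (i : Fin n) :
    ∏ j ∈ Finset.univ.erase i, (x i - x j) ≠ 0 :=
  Finset.prod_ne_zero_iff.2 fun _ hj =>
    sub_ne_zero.2 fun h => (Finset.ne_of_mem_erase hj) (hx h.symm)

/-- Lagrange interpolation of a polynomial of degree `n` at `n` nodes, in terms of the Weierstrass
corrections. -/
lemma eq_prod_add_sum_W {f : K[X]} (hf : f.natDegree = n) (hf0 : f ≠ 0) {x : Fin n → K}
    (hx : Function.Injective x) :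
    f = C f.leadingCoeff * ∏ j, (X - C (x j)) +
      ∑ i, C (f.leadingCoeff * W f x i) * ∏ j ∈ Finset.univ.erase i, (X - C (x j)) := by
  have hlc : f.leadingCoeff ≠ 0 := leadingCoeff_ne_zero.2 hf0
  have hdeg : (C f.leadingCoeff * ∏ j, (X - C (x j))).degree = n := by
    rw [degree_C_mul hlc, degree_prod_X_sub_C, Finset.card_univ, Fintype.card_fin]
  have hmonic : (∏ j, (X - C (x j))).Monic := monic_prod_of_monic _ _ fun j _ => monic_X_sub_C _
  rw [← sub_eq_iff_eq_add']
  refine Polynomial.eq_of_degrees_lt_of_eval_index_eq (s := Finset.univ) (v := x) hx.injOn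
    ?_ ?_ fun k _ => ?_
  · have h1 : f.degree = n := by rw [degree_eq_natDegree hf0, hf]
    rw [Finset.card_univ, Fintype.card_fin]
    conv_rhs => rw [← h1]
    refine degree_sub_lt_left (h1.trans hdeg.symm) hf0 ?_
    rw [leadingCoeff_mul, leadingCoeff_C, hmonic.leadingCoeff, mul_one]
  · refine (degree_sum_le _ _).trans_lt ?_
    refine (Finset.sup_lt_iff (WithBot.bot_lt_coe _)).2 fun i hi => ?_
    refine (degree_mul_le _ _).trans_lt ?_
    refine (add_le_add_left degree_C_le _).trans_lt ?_
    rw [zero_add, degree_prod_X_sub_C]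
    exact_mod_cast Finset.card_erase_lt_of_mem hi
  · rw [eval_sub, eval_mul, eval_C, eval_prod_X_sub_C,
      Finset.prod_eq_zero (Finset.mem_univ k) (sub_self _), mul_zero, sub_zero, eval_finsetSum,
      Finset.sum_eq_single k]
    · rw [eval_mul, eval_C, eval_prod_X_sub_C, W, mul_right_comm,
        mul_div_cancel₀ _ (mul_ne_zero hlc (prod_erase_sub_ne_zero hx k))]
    · intro i _ hik
      rw [eval_mul, eval_prod_X_sub_C, Finset.prod_eq_zero
        (Finset.mem_erase.2 ⟨hik.symm, Finset.mem_univ k⟩) (sub_self _), mul_zero]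
    · exact fun h => (h (Finset.mem_univ k)).elim

/-- The sum `∑_{j ≠ i} W_j(x) / (z - x_j)`. -/
noncomputable def corrSum (f : K[X]) (x : Fin n → K) (i : Fin n) (z : K) : K :=
  ∑ j ∈ Finset.univ.erase i, W f x j / (z - x j)

lemma eval_eq_corrSum {f : K[X]} (hf : f.natDegree = n) (hf0 : f ≠ 0) {x : Fin n → K}
    (hx : Function.Injective x) {i : Fin n} {z : K} (hz : ∀ j, j ≠ i → z ≠ x j) :
    f.eval z = f.leadingCoeff * (∏ j ∈ Finset.univ.erase i, (z - x j)) *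
      ((z - x i) * (1 + corrSum f x i z) + W f x i) := by
  conv_lhs => rw [eq_prod_add_sum_W hf hf0 hx]
  rw [eval_add, eval_mul, eval_C, eval_prod_X_sub_C, eval_finsetSum,
    ← Finset.add_sum_erase _ _ (Finset.mem_univ i),
    ← Finset.mul_prod_erase _ _ (Finset.mem_univ i)]
  have h : ∀ k ∈ Finset.univ.erase i,
      (C (f.leadingCoeff * W f x k) * ∏ j ∈ Finset.univ.erase k, (X - C (x j))).eval z =
        f.leadingCoeff * (∏ j ∈ Finset.univ.erase i, (z - x j)) * (z - x i) *
          (W f x k / (z - x k)) := by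
    intro k hk
    have hki := Finset.ne_of_mem_erase hk
    have hzk : z - x k ≠ 0 := sub_ne_zero.2 (hz k hki)
    have h1 : (z - x k) * ∏ j ∈ Finset.univ.erase k, (z - x j) =
        (z - x i) * ∏ j ∈ Finset.univ.erase i, (z - x j) := by
      rw [Finset.mul_prod_erase _ (fun j => z - x j) (Finset.mem_univ k),
        Finset.mul_prod_erase _ (fun j => z - x j) (Finset.mem_univ i)]
    rw [eval_mul, eval_C, eval_prod_X_sub_C]
    field_simp
    linear_combination (f.leadingCoeff * W f x k) * h1
  rw [Finset.sum_congr rfl h, ← Finset.mul_sum, eval_mul, eval_C, eval_prod_X_sub_C, corrSum]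
  ring

lemma eq_C_mul_prod_of_isRoot {f : K[X]} (hf : f.natDegree = n) (hf0 : f ≠ 0) {ξ : Fin n → K}
    (hξ : Function.Injective ξ) (hr : ∀ i, f.IsRoot (ξ i)) :
    f = C f.leadingCoeff * ∏ j, (X - C (ξ j)) := by
  have hW : ∀ i, W f ξ i = 0 := fun i => by rw [W, (hr i).eq_zero, zero_div]
  conv_lhs => rw [eq_prod_add_sum_W hf hf0 hξ]
  simp [hW]

lemma hasOnlySimpleZeros_of_isRoot {f : K[X]} (hf : f.natDegree = n) (hf0 : f ≠ 0)
    {ξ : Fin n → K} (hξ : Function.Injective ξ) (hr : ∀ i, f.IsRoot (ξ i)) :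
    HasOnlySimpleZeros f := by
  have hsep : f.Separable := by
    rw [eq_C_mul_prod_of_isRoot hf hf0 hξ hr]
    refine Separable.unit_mul (isUnit_C.2 (leadingCoeff_ne_zero.2 hf0).isUnit) ?_
    exact separable_prod_X_sub_C_iff.2 hξ
  exact fun z hz => le_antisymm (rootMultiplicity_le_one_of_separable hsep z)
    ((rootMultiplicity_pos hf0).2 hz)

end Interpolation

/-! ### Zeros from small values, without completeness. -/

section SmallValues

variable {K : Type*} [NormedField K]

lemma exists_pos_le_norm_prod_sub (s : Multiset K) (c : K) (r : ℝ) (hs : ∀ ζ ∈ s, r < ‖ζ - c‖) :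
    ∃ m > 0, ∀ z, ‖z - c‖ ≤ r → m ≤ ‖(s.map (z - ·)).prod‖ := by
  induction s using Multiset.induction_on with
  | empty => exact ⟨1, one_pos, fun z _ => by simp⟩
  | cons ζ s ih =>
    obtain ⟨m, hm, hms⟩ := ih fun ξ hξ => hs ξ (Multiset.mem_cons_of_mem hξ)
    have hζ := hs ζ (Multiset.mem_cons_self ζ s)
    refine ⟨(‖ζ - c‖ - r) * m, mul_pos (sub_pos.2 hζ) hm, fun z hz => ?_⟩
    rw [Multiset.map_cons, Multiset.prod_cons, norm_mul]
    have h : ‖ζ - c‖ - r ≤ ‖z - ζ‖ := by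
      have := norm_sub_le_norm_sub_add_norm_sub ζ z c
      rw [norm_sub_rev ζ z] at this
      linarith
    exact mul_le_mul h (hms z hz) hm.le (norm_nonneg _)

/-- If every zero lay outside the closed disc, each linear factor, hence `f`, would be bounded away
from zero on it. -/
lemma exists_isRoot_of_small_values [IsAlgClosed K] {f : K[X]} (hf0 : f ≠ 0) (c : K) (r : ℝ)
    (h : ∀ ε > 0, ∃ z, ‖z - c‖ ≤ r ∧ ‖f.eval z‖ < ε) : ∃ ζ, f.IsRoot ζ ∧ ‖ζ - c‖ ≤ r := by
  by_contra! hcon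
  obtain ⟨m, hm, hms⟩ := exists_pos_le_norm_prod_sub f.roots c r
    fun ζ hζ => hcon ζ (isRoot_of_mem_roots hζ)
  have hlc : 0 < ‖f.leadingCoeff‖ := norm_pos_iff.2 (leadingCoeff_ne_zero.2 hf0)
  obtain ⟨z, hz, hzε⟩ := h (‖f.leadingCoeff‖ * m) (mul_pos hlc hm)
  rw [(IsAlgClosed.splits f).eval_eq_prod_roots, norm_mul] at hzε
  exact absurd (hms z hz) (not_le.2 (lt_of_mul_lt_mul_left hzε hlc.le))

/-- The residual decays geometrically along an orbit; no limit of the orbit is needed. -/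
lemma exists_norm_sub_lt_of_contracting (φ : K → K) (s : Set K) (hs : s.Nonempty)
    (hφ : ∀ z ∈ s, φ z ∈ s) {L : ℝ} (hL0 : 0 ≤ L) (hL : L < 1)
    (hLip : ∀ z ∈ s, ∀ u ∈ s, ‖φ z - φ u‖ ≤ L * ‖z - u‖) {ε : ℝ} (hε : 0 < ε) :
    ∃ z ∈ s, ‖z - φ z‖ < ε := by
  obtain ⟨z₀, hz₀⟩ := hs
  have key : ∀ k : ℕ, φ^[k] z₀ ∈ s ∧ ‖φ^[k] z₀ - φ (φ^[k] z₀)‖ ≤ L ^ k * ‖z₀ - φ z₀‖ := by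
    intro k
    induction k with
    | zero => simpa using hz₀
    | succ k ih =>
      rw [Function.iterate_succ_apply', pow_succ', mul_assoc]
      exact ⟨hφ _ ih.1, (hLip _ ih.1 _ (hφ _ ih.1)).trans (mul_le_mul_of_nonneg_left ih.2 hL0)⟩
  have hlim : Tendsto (fun k : ℕ => L ^ k * ‖z₀ - φ z₀‖) atTop (𝓝 0) := by
    simpa using (tendsto_pow_atTop_nhds_zero_of_lt_one hL0 hL).mul_const ‖z₀ - φ z₀‖
  obtain ⟨k, hk⟩ := (hlim.eventually (gt_mem_nhds hε)).exists
  exact ⟨_, (key k).1, (key k).2.trans_lt hk⟩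

end SmallValues

/-! ### The quadratic equation behind `alpha`. -/

section Alpha

/-- `α` is a root of `t α² - (1 - (a - 1) t) α + 1 = 0`, in a form that is also valid at `t = 0`.
The bound on `t` makes the discriminant nonnegative. -/
lemma alpha_spec {a t : ℝ} (ha : 1 ≤ a) (ht : 0 ≤ t) (hta : t ≤ 1 / (1 + Real.sqrt a) ^ 2) :
    0 < alpha a t ∧ alpha a t * (1 - hFun a t - a * t) = 1 - hFun a t := by
  obtain ⟨u, hu, rfl⟩ : ∃ u, 0 ≤ u ∧ t = u ^ 2 := ⟨√t, Real.sqrt_nonneg t, (Real.sq_sqrt ht).symm⟩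
  have hv : 0 ≤ √a := Real.sqrt_nonneg a
  have hva : √a ^ 2 = a := Real.sq_sqrt (by linarith)
  have huv : u * (1 + √a) ≤ 1 := by
    rw [le_div_iff₀ (by positivity), ← mul_pow] at hta
    exact (pow_le_one_iff_of_nonneg (by positivity) two_ne_zero).1 hta
  set s := 1 - (a - 1) * u ^ 2 with hs
  have hsu : 2 * u ≤ s := by
    -- With `t = u²` the discriminant is `(s - 2u)(s + 2u)`; this factorisation is the source of the
    -- threshold `1 / (1 + √a)²`.
    have : s - 2 * u = (1 - u * (1 + √a)) * (1 - u + u * √a) := by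
      rw [hs]; linear_combination u ^ 2 * hva
    have h1 : 0 ≤ u * √a := mul_nonneg hu hv
    nlinarith [mul_nonneg (by linarith : 0 ≤ 1 - u * (1 + √a))
      (by nlinarith : 0 ≤ 1 - u + u * √a)]
  have hs0 : 0 < s := by
    rcases hu.eq_or_lt with h | h
    · rw [hs, ← h]; norm_num
    · linarith
  have hD : 0 ≤ s ^ 2 - 4 * u ^ 2 := by nlinarith
  have hr0 := Real.sqrt_nonneg (s ^ 2 - 4 * u ^ 2)
  have hr := Real.sq_sqrt hD
  have hα : alpha a (u ^ 2) = 2 / (s + √(s ^ 2 - 4 * u ^ 2)) := rfl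
  set r := √(s ^ 2 - 4 * u ^ 2)
  have hsr : 0 < s + r := by linarith
  refine ⟨by rw [hα]; positivity, ?_⟩
  rw [hFun, hα]
  field_simp
  rw [hs] at *
  linear_combination -hr

lemma hFun_facts {a t : ℝ} (ha : 1 ≤ a) (ht : 0 ≤ t) (hta : t ≤ 1 / (1 + Real.sqrt a) ^ 2)
    (hΨ : (1 + 2 * hFun a t) * (1 + a * hFun a t) < 2) :
    0 ≤ hFun a t ∧ 2 * hFun a t < 1 ∧ hFun a t * alpha a t < 1 := by
  obtain ⟨hα, hαeq⟩ := alpha_spec ha ht hta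
  have hh : hFun a t = t * alpha a t := rfl
  set h := hFun a t
  set α := alpha a t
  have h0 : 0 ≤ h := by rw [hh]; positivity
  have hah : 0 ≤ a * h := by positivity
  have h2 : 2 * h < 1 := by nlinarith
  refine ⟨h0, h2, ?_⟩
  rcases ht.eq_or_lt with rfl | ht'
  · rw [hh]; simp
  have hpos : 0 < h := by rw [hh]; positivity
  have h3 : a * h < 1 - 2 * h := by nlinarith
  have h4 : a * h ^ 2 < (1 - h) ^ 2 := by nlinarith
  have h5 : h * (1 - h) = t * (1 - h + a * h) := by
    have : t * (α * (1 - h - a * t)) = t * (1 - h) := by rw [hαeq]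
    have h6 : t * (α * (1 - h - a * t)) = h * (1 - h - a * t) := by rw [hh]; ring
    linarith
  -- Since `h² = t * (h * α)`, this is equivalent to the goal when `t > 0`.
  have h6 : h ^ 2 < t := by
    have : h ^ 2 * (1 - h + a * h) < t * (1 - h + a * h) := by
      rw [← h5]; nlinarith
    exact lt_of_mul_lt_mul_right this (by linarith)
  have h7 : h ^ 2 = t * (h * α) := by rw [hh]; ring
  nlinarith

end Alpha

/-! ### Discs containing zeros. -/

section Localization

variable {K : Type*} [NormedField K] {n : ℕ} {p q : ℝ≥0∞}

lemma div_sep_le_initFun (hp : 1 ≤ p) (f : K[X]) (x : Fin n → K) (i : Fin n) :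
    ‖W f x i‖ / sep x i ≤ initFun p f x :=
  (le_abs_self _).trans (norm_apply_le_pNorm hp (fun i => ‖W f x i‖ / sep x i) i)

lemma initFun_nonneg (hp : 1 ≤ p) (f : K[X]) (x : Fin n → K) : 0 ≤ initFun p f x :=
  pNorm_nonneg hp _

/-- A closed disc about `x i` whose radius is controlled by `W f x i` contains a zero of `f`. -/
lemma exists_isRoot_norm_sub_le [IsAlgClosed K] (hn : 2 ≤ n) (hp : 1 ≤ p)
    (hpq : 1 / p + 1 / q = 1) {f : K[X]} (hf : f.natDegree = n) (hf0 : f ≠ 0) {x : Fin n → K}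
    (hx : Function.Injective x) {t α h : ℝ} (ht : t = initFun p f x) (hh : h = t * α)
    (hα : 0 < α) (hαeq : α * (1 - h - aConst n q * t) = 1 - h) (h2 : 2 * h < 1) (hhα : h * α < 1)
    (i : Fin n) : ∃ ζ, f.IsRoot ζ ∧ ‖ζ - x i‖ ≤ α * ‖W f x i‖ := by
  have ht0 : 0 ≤ t := ht ▸ initFun_nonneg hp f x
  have h0 : 0 ≤ h := by rw [hh]; positivity
  have ha0 : 0 ≤ aConst n q := zero_le_one.trans (one_le_aConst hn q)
  set a := aConst n q
  have h1h : 0 < 1 - h := by linarith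
  set e : Fin n → ℝ := fun j => ‖W f x j‖ / sep x j with he
  have he0 : ∀ j, 0 ≤ e j := fun j => div_nonneg (norm_nonneg _) (sep_nonneg x j)
  have het : ∀ j, e j ≤ t := fun j => ht ▸ div_sep_le_initFun hp f x j
  have hsum : ∑ j ∈ Finset.univ.erase i, e j ≤ a * t := by
    have := sum_erase_norm_le hp hpq e i
    simp only [Real.norm_of_nonneg (he0 _)] at this
    rwa [ht]
  have hW : ∀ j k, k ≠ j → ‖W f x j‖ ≤ e j * ‖x j - x k‖ := fun j k hk => by
    rw [← div_mul_cancel₀ ‖W f x j‖ (sep_pos hn hx j).ne']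
    exact mul_le_mul_of_nonneg_left (sep_le x hk) (he0 j)
  have hfar : ∀ z, ‖z - x i‖ ≤ α * ‖W f x i‖ → ∀ j, j ≠ i →
      0 < ‖x i - x j‖ ∧ (1 - h) * ‖x i - x j‖ ≤ ‖z - x j‖ := by
    intro z hz j hj
    have h3 : ‖W f x i‖ ≤ t * ‖x i - x j‖ :=
      (hW i j hj).trans (mul_le_mul_of_nonneg_right (het i) (norm_nonneg _))
    have h4 := norm_sub_le_norm_sub_add_norm_sub (x i) z (x j)
    rw [norm_sub_rev (x i) z] at h4
    refine ⟨norm_pos_iff.2 (sub_ne_zero.2 fun h => hj (hx h.symm)), ?_⟩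
    have h5 : α * ‖W f x i‖ ≤ h * ‖x i - x j‖ := by
      rw [hh]; nlinarith
    linarith
  have hzne : ∀ z, ‖z - x i‖ ≤ α * ‖W f x i‖ → ∀ j, j ≠ i → 0 < ‖z - x j‖ := fun z hz j hj =>
    (mul_pos h1h (hfar z hz j hj).1).trans_le (hfar z hz j hj).2
  have hS : ∀ z, ‖z - x i‖ ≤ α * ‖W f x i‖ → ‖corrSum f x i z‖ ≤ a * t / (1 - h) := by
    intro z hz
    calc ‖corrSum f x i z‖ ≤ ∑ j ∈ Finset.univ.erase i, ‖W f x j / (z - x j)‖ := norm_sum_le _ _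
      _ ≤ ∑ j ∈ Finset.univ.erase i, e j / (1 - h) := by
          refine Finset.sum_le_sum fun j hj => ?_
          have hj := Finset.ne_of_mem_erase hj
          rw [norm_div, div_le_div_iff₀ (hzne z hz j hj) h1h]
          have h3 := hW j i hj.symm
          rw [norm_sub_rev] at h3
          have h4 := mul_le_mul_of_nonneg_left (hfar z hz j hj).2 (he0 j)
          nlinarith
      _ ≤ a * t / (1 - h) := by
          rw [← Finset.sum_div]
          gcongr
  -- The defining equation of `α` says that the lower bound for `|1 + S_i|` is `1 / α`, so that `φ`
  -- below preserves the disc.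
  have hαinv : 1 - a * t / (1 - h) = α⁻¹ := by
    refine eq_inv_of_mul_eq_one_left ?_
    field_simp
    linarith
  have hden : ∀ z, ‖z - x i‖ ≤ α * ‖W f x i‖ → α⁻¹ ≤ ‖1 + corrSum f x i z‖ := by
    intro z hz
    have := norm_sub_le (1 + corrSum f x i z) (corrSum f x i z)
    rw [add_sub_cancel_right, norm_one] at this
    linarith [hS z hz]
  have hden0 : ∀ z, ‖z - x i‖ ≤ α * ‖W f x i‖ → 1 + corrSum f x i z ≠ 0 := fun z hz =>
    norm_pos_iff.1 ((inv_pos.2 hα).trans_le (hden z hz))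
  have hdeninv : ∀ z, ‖z - x i‖ ≤ α * ‖W f x i‖ → ‖(1 + corrSum f x i z)⁻¹‖ ≤ α := fun z hz => by
    rw [norm_inv]
    exact inv_le_of_inv_le₀ hα (hden z hz)
  set φ : K → K := fun z => x i - W f x i * (1 + corrSum f x i z)⁻¹ with hφ
  have hmaps : ∀ z ∈ {z | ‖z - x i‖ ≤ α * ‖W f x i‖}, φ z ∈ {z | ‖z - x i‖ ≤ α * ‖W f x i‖} := by
    intro z hz
    simp only [Set.mem_ofPred_eq, hφ, sub_sub_cancel_left, norm_neg, norm_mul]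
    rw [mul_comm]
    exact mul_le_mul_of_nonneg_right (hdeninv z hz) (norm_nonneg _)
  have hdiff : ∀ z, ‖z - x i‖ ≤ α * ‖W f x i‖ → ∀ u, ‖u - x i‖ ≤ α * ‖W f x i‖ →
      ‖W f x i‖ * ‖corrSum f x i z - corrSum f x i u‖ ≤
        t * (a * t) / (1 - h) ^ 2 * ‖z - u‖ := by
    intro z hz u hu
    calc ‖W f x i‖ * ‖corrSum f x i z - corrSum f x i u‖
        ≤ ‖W f x i‖ * ∑ j ∈ Finset.univ.erase i, ‖W f x j / (z - x j) - W f x j / (u - x j)‖ := by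
          gcongr
          rw [corrSum, corrSum, ← Finset.sum_sub_distrib]
          exact norm_sum_le _ _
      _ ≤ ∑ j ∈ Finset.univ.erase i, t * e j / (1 - h) ^ 2 * ‖z - u‖ := by
          rw [Finset.mul_sum]
          refine Finset.sum_le_sum fun j hj => ?_
          have hj := Finset.ne_of_mem_erase hj
          have hzj := hzne z hz j hj
          have huj := hzne u hu j hj
          have h3 : W f x j / (z - x j) - W f x j / (u - x j) =
              W f x j * (u - z) / ((z - x j) * (u - x j)) := by
            rw [div_sub_div _ _ (norm_pos_iff.1 hzj) (norm_pos_iff.1 huj)]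
            ring
          rw [h3, norm_div, norm_mul, norm_mul, norm_sub_rev u z, mul_div_assoc', div_mul_eq_mul_div,
            div_le_div_iff₀ (mul_pos hzj huj) (by positivity)]
          have hWi : ‖W f x i‖ ≤ t * ‖x i - x j‖ :=
            (hW i j hj).trans (mul_le_mul_of_nonneg_right (het i) (norm_nonneg _))
          have hWj := hW j i hj.symm
          rw [norm_sub_rev] at hWj
          calc ‖W f x i‖ * (‖W f x j‖ * ‖z - u‖) * (1 - h) ^ 2
              ≤ (t * ‖x i - x j‖) * ((e j * ‖x i - x j‖) * ‖z - u‖) * (1 - h) ^ 2 := by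
                have := he0 j
                gcongr
            _ = t * e j * ‖z - u‖ * (((1 - h) * ‖x i - x j‖) * ((1 - h) * ‖x i - x j‖)) := by ring
            _ ≤ t * e j * ‖z - u‖ * (‖z - x j‖ * ‖u - x j‖) := by
                have := he0 j
                have := (hfar z hz j hj).2
                have := (hfar u hu j hj).2
                gcongr
      _ = t * (∑ j ∈ Finset.univ.erase i, e j) / (1 - h) ^ 2 * ‖z - u‖ := by
          rw [← Finset.sum_mul, ← Finset.sum_div, ← Finset.mul_sum]
      _ ≤ _ := by gcongr
  have hLip : ∀ z ∈ {z | ‖z - x i‖ ≤ α * ‖W f x i‖}, ∀ u ∈ {z | ‖z - x i‖ ≤ α * ‖W f x i‖},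
      ‖φ z - φ u‖ ≤ h * (α * (a * t)) / (1 - h) ^ 2 * ‖z - u‖ := by
    intro z hz u hu
    have h3 : φ z - φ u = (1 + corrSum f x i z)⁻¹ * (1 + corrSum f x i u)⁻¹ *
        (W f x i * (corrSum f x i z - corrSum f x i u)) := by
      have := hden0 z hz
      have := hden0 u hu
      simp only [hφ]
      field_simp
      ring
    rw [h3, norm_mul, norm_mul, norm_mul (W f x i)]
    calc _ ≤ α * α * (t * (a * t) / (1 - h) ^ 2 * ‖z - u‖) := by
          refine mul_le_mul (mul_le_mul (hdeninv z hz) (hdeninv u hu) (norm_nonneg _) hα.le)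
            (hdiff z hz u hu) (by positivity) (by positivity)
      _ = _ := by rw [hh]; ring
  have hL0 : 0 ≤ h * (α * (a * t)) / (1 - h) ^ 2 := by positivity
  have hL : h * (α * (a * t)) / (1 - h) ^ 2 < 1 := by
    rw [div_lt_one (by positivity)]
    -- The Lipschitz constant becomes `h (α - 1) / (1 - h)`, which is below `1` exactly when `h * α
    -- < 1`.
    have h3 : α * (a * t) = (α - 1) * (1 - h) := by linarith
    rw [h3]
    nlinarith
  refine exists_isRoot_of_small_values hf0 (x i) _ fun ε hε => ?_
  -- `M` bounds on the disc the cofactor of `z - φ z` in `f(z)`; `M + 1` avoids dividing by zero.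
  set M := ‖f.leadingCoeff‖ * (∏ j ∈ Finset.univ.erase i, (α * ‖W f x i‖ + ‖x i - x j‖)) *
    (1 + a * t / (1 - h)) with hM
  have hM0 : 0 ≤ M := by positivity
  obtain ⟨z, hz, hzε⟩ := exists_norm_sub_lt_of_contracting φ {z | ‖z - x i‖ ≤ α * ‖W f x i‖}
    ⟨x i, by simp only [Set.mem_ofPred_eq, sub_self, norm_zero]; positivity⟩ hmaps hL0 hL hLip
    (show 0 < ε / (M + 1) by positivity)
  refine ⟨z, hz, ?_⟩
  have hfz : f.eval z = f.leadingCoeff * (∏ j ∈ Finset.univ.erase i, (z - x j)) *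
      (1 + corrSum f x i z) * (z - φ z) := by
    rw [eval_eq_corrSum hf hf0 hx
      fun j hj => sub_ne_zero.1 (norm_pos_iff.1 (hzne z hz j hj)), mul_assoc _ (1 + _) (z - _)]
    congr 1
    have := hden0 z hz
    simp only [hφ]
    field_simp
    ring
  have hle : ‖f.eval z‖ ≤ M * ‖z - φ z‖ := by
    rw [hfz, norm_mul, norm_mul, norm_mul, norm_prod, hM]
    gcongr with j _
    · calc ‖z - x j‖ ≤ ‖z - x i‖ + ‖x i - x j‖ := norm_sub_le_norm_sub_add_norm_sub _ _ _
        _ ≤ _ := by gcongr; exact hz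
    · exact (norm_add_le _ _).trans (by rw [norm_one]; gcongr; exact hS z hz)
  calc ‖f.eval z‖ ≤ M * ‖z - φ z‖ := hle
    _ ≤ (M + 1) * ‖z - φ z‖ := by gcongr; linarith
    _ < (M + 1) * (ε / (M + 1)) := by gcongr
    _ = ε := by field_simp

lemma Psi_eq (hn : 2 ≤ n) (hpq : 1 / p + 1 / q = 1) (t : ℝ) :
    Psi n p t = (1 + 2 * t) * (1 + aConst n q * t / ((n - 1 : ℕ) : ℝ)) ^ (n - 1) := by
  rw [Psi, div_rpow_eq_aConst_mul_div hn hpq]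

lemma hFun_aConst_facts (hn : 2 ≤ n) (hpq : 1 / p + 1 / q = 1) {t : ℝ} (ht : 0 ≤ t)
    (hE : t ≤ 1 / (1 + Real.sqrt (aConst n q)) ^ 2) (hΩ : Omega n p q t < 2) :
    0 ≤ hFun (aConst n q) t ∧ 2 * hFun (aConst n q) t < 1 ∧
      hFun (aConst n q) t * alpha (aConst n q) t < 1 := by
  have ha := one_le_aConst hn q
  have h0 : 0 ≤ hFun (aConst n q) t := mul_nonneg ht (alpha_spec ha ht hE).1.le
  refine hFun_facts ha ht hE (lt_of_le_of_lt ?_ hΩ)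
  rw [Omega, Psi_eq hn hpq]
  set h := hFun (aConst n q) t
  set a := aConst n q
  have hm : (0 : ℝ) < (n - 1 : ℕ) := by exact_mod_cast (by omega : 0 < n - 1)
  have h1 : 0 ≤ a * h / (n - 1 : ℕ) := by positivity
  -- Bernoulli's inequality weakens the power in `Psi` to the linear factor `1 + a * h`.
  have := one_add_mul_le_pow (by linarith : -2 ≤ a * h / (n - 1 : ℕ)) (n - 1)
  rw [mul_div_cancel₀ _ hm.ne'] at this
  gcongr

/-- Under the initial conditions every disc of radius `α(E_f(x)) |W_i(x)|` contains a zero. -/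
lemma exists_isRoot_of_initFun [IsAlgClosed K] (hn : 2 ≤ n) (hp : 1 ≤ p)
    (hpq : 1 / p + 1 / q = 1) {f : K[X]} (hf : f.natDegree = n) (hf0 : f ≠ 0) {x : Fin n → K}
    (hx : Function.Injective x)
    (hE : initFun p f x ≤ 1 / (1 + Real.sqrt (aConst n q)) ^ 2)
    (hΩ : Omega n p q (initFun p f x) < 2) (i : Fin n) :
    ∃ ζ, f.IsRoot ζ ∧ ‖x i - ζ‖ ≤ alpha (aConst n q) (initFun p f x) * ‖W f x i‖ := by
  have ht := initFun_nonneg hp f x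
  obtain ⟨hα, hαeq⟩ := alpha_spec (one_le_aConst hn q) ht hE
  obtain ⟨-, h2, h3⟩ := hFun_aConst_facts hn hpq ht hE hΩ
  obtain ⟨ζ, hζ, hle⟩ := exists_isRoot_norm_sub_le hn hp hpq hf hf0 hx rfl rfl hα hαeq h2 h3 i
  exact ⟨ζ, hζ, norm_sub_rev ζ (x i) ▸ hle⟩

lemma alpha_mul_norm_W_le (hn : 2 ≤ n) (hp : 1 ≤ p) {f : K[X]} {x : Fin n → K}
    (hx : Function.Injective x) {a : ℝ} (hα : 0 < alpha a (initFun p f x)) (i : Fin n) :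
    alpha a (initFun p f x) * ‖W f x i‖ ≤ hFun a (initFun p f x) * sep x i := by
  rw [hFun, mul_comm (initFun p f x), mul_assoc]
  gcongr
  exact (div_le_iff₀ (sep_pos hn hx i)).1 (div_sep_le_initFun hp f x i)

end Localization

/-! ### Local convergence around a root-vector. -/

section LocalConvergence

variable {K : Type*} [NormedField K] {n : ℕ} {p q : ℝ≥0∞}

/-- The function `‖(x - ξ) / d(x)‖_p`. -/
noncomputable def errFun (p : ℝ≥0∞) (x ξ : Fin n → K) : ℝ :=
  pNorm p (fun i => ‖x i - ξ i‖ / sep x i)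

lemma norm_sub_le_errFun_mul_sep (hn : 2 ≤ n) (hp : 1 ≤ p) {x : Fin n → K}
    (hx : Function.Injective x) (ξ : Fin n → K) (i : Fin n) :
    ‖x i - ξ i‖ ≤ errFun p x ξ * sep x i :=
  (div_le_iff₀ (sep_pos hn hx i)).1 ((le_abs_self _).trans
    (norm_apply_le_pNorm hp (fun i => ‖x i - ξ i‖ / sep x i) i))

/-- The number `(1 + c / (n - 1)) ^ (n - 1) - 1`. -/
noncomputable def powBound (n : ℕ) (c : ℝ) : ℝ :=
  (1 + c / ((n - 1 : ℕ) : ℝ)) ^ (n - 1) - 1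

lemma powBound_nonneg (n : ℕ) {c : ℝ} (hc : 0 ≤ c) : 0 ≤ powBound n c :=
  sub_nonneg.2 (one_le_pow₀ (le_add_of_nonneg_right (by positivity)))

/-- Factoring `f` over `ξ`, the new error is minus the old one times `∏ (1 + (y_j - ξ_j) / (x_i -
y_j)) - 1`, so a better `y` gives a smaller factor. -/
lemma norm_weierstrass_step_sub_le (hn : 2 ≤ n) {f : K[X]} (hf0 : f ≠ 0) {ξ : Fin n → K}
    (hξ : ∀ z, f.eval z = f.leadingCoeff * ∏ j, (z - ξ j)) {x y : Fin n → K} {i : Fin n}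
    (hxy : ∀ j, j ≠ i → x i ≠ y j) {v : Fin n → ℝ} {k c : ℝ} (hk : 0 ≤ k) (hk' : k ≤ 1)
    (hc : 0 ≤ c) (hv0 : ∀ j, 0 ≤ v j)
    (hv : ∀ j, j ≠ i → ‖y j - ξ j‖ ≤ v j * ‖x i - y j‖)
    (hvs : ∑ j ∈ Finset.univ.erase i, v j ≤ k * c) :
    ‖x i - f.eval (x i) / (f.leadingCoeff * ∏ j ∈ Finset.univ.erase i, (x i - y j)) - ξ i‖ ≤
      powBound n c * k * ‖x i - ξ i‖ := by
  have hlc : f.leadingCoeff ≠ 0 := leadingCoeff_ne_zero.2 hf0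
  have hne : ∀ j ∈ Finset.univ.erase i, x i - y j ≠ 0 := fun j hj =>
    sub_ne_zero.2 (hxy j (Finset.ne_of_mem_erase hj))
  have hcard : (Finset.univ.erase i).card = n - 1 := by
    rw [Finset.card_erase_of_mem (Finset.mem_univ i), Finset.card_univ, Fintype.card_fin]
  have hsne : (Finset.univ.erase i).Nonempty := Finset.card_pos.1 (by omega)
  have h1 : x i - f.eval (x i) / (f.leadingCoeff * ∏ j ∈ Finset.univ.erase i, (x i - y j)) - ξ i =
      -((∏ j ∈ Finset.univ.erase i, (1 + (y j - ξ j) / (x i - y j)) - 1) * (x i - ξ i)) := by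
    have h2 : ∏ j ∈ Finset.univ.erase i, (1 + (y j - ξ j) / (x i - y j)) =
        (∏ j ∈ Finset.univ.erase i, (x i - ξ j)) / ∏ j ∈ Finset.univ.erase i, (x i - y j) := by
      rw [← Finset.prod_div_distrib]
      refine Finset.prod_congr rfl fun j hj => ?_
      have := hne j hj
      field_simp
      ring
    rw [h2, hξ, ← Finset.mul_prod_erase _ _ (Finset.mem_univ i)]
    have := Finset.prod_ne_zero_iff.2 hne
    field_simp
    ring
  rw [h1, norm_neg, norm_mul]
  refine mul_le_mul_of_nonneg_right ?_ (norm_nonneg _)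
  calc _ ≤ ∏ j ∈ Finset.univ.erase i, (1 + ‖(y j - ξ j) / (x i - y j)‖) - 1 :=
        norm_prod_one_add_sub_one_le_prod _ _
    _ ≤ ∏ j ∈ Finset.univ.erase i, (1 + v j) - 1 := by
        gcongr with j hj
        rw [norm_div]
        exact (div_le_iff₀ (norm_pos_iff.2 (hne j hj))).2 (hv j (Finset.ne_of_mem_erase hj))
    _ ≤ (1 + (∑ j ∈ Finset.univ.erase i, v j) / ((n - 1 : ℕ) : ℝ)) ^ (n - 1) - 1 := by
        rw [← hcard]
        exact sub_le_sub_right (prod_one_add_le_pow _ hsne v fun j _ => hv0 j) 1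
    _ ≤ (1 + k * (c / ((n - 1 : ℕ) : ℝ))) ^ (n - 1) - 1 := by
        rw [← mul_div_assoc]
        have : 0 ≤ ∑ j ∈ Finset.univ.erase i, v j := Finset.sum_nonneg fun j _ => hv0 j
        gcongr
    _ ≤ powBound n c * k := by
        rw [mul_comm (powBound n c)]
        exact one_add_mul_pow_sub_one_le hk hk' (by positivity) _

lemma mul_norm_sub_le_of_norm_sub_le {x y ξ : Fin n → K} {τ b B : ℝ}
    (hx : ∀ j, ‖x j - ξ j‖ ≤ τ * sep x j) (hτ : 0 ≤ τ) (hb : 0 ≤ b) (hbB : b ≤ B)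
    (hy : ∀ j, ‖y j - ξ j‖ ≤ b * ‖x j - ξ j‖) {i j : Fin n} (hij : i ≠ j) :
    (1 - (1 + B) * τ) * ‖x i - x j‖ ≤ ‖x i - y j‖ ∧
      (1 - 2 * ((1 + B) * τ)) * ‖x i - x j‖ ≤ ‖y i - y j‖ := by
  have key : ∀ j, ‖x j - y j‖ ≤ (1 + B) * τ * sep x j := fun j => by
    have h1 := norm_sub_le_norm_sub_add_norm_sub (x j) (ξ j) (y j)
    rw [norm_sub_rev (ξ j)] at h1
    have h2 : (1 + b) * ‖x j - ξ j‖ ≤ (1 + B) * (τ * sep x j) := by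
      have := hx j
      have : 0 ≤ 1 + B := by linarith
      gcongr
    linarith [hy j]
  have hBτ : 0 ≤ (1 + B) * τ := mul_nonneg (by linarith) hτ
  have hj := (key j).trans (mul_le_mul_of_nonneg_left (sep_le x hij) hBτ)
  have hi := (key i).trans (mul_le_mul_of_nonneg_left (sep_le x hij.symm) hBτ)
  rw [norm_sub_rev (x j) (x i)] at hj
  have h3 := norm_sub_le_norm_sub_add_norm_sub (x i) (y j) (x j)
  have h4 := norm_sub_le_norm_sub_add_norm_sub (x i) (y i) (y j)
  rw [norm_sub_rev (y j)] at h3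
  constructor <;> linarith

/-- All the iteration functions contract towards the root-vector. -/
lemma iterMap_succ_bound (hn : 2 ≤ n) (hp : 1 ≤ p) (hpq : 1 / p + 1 / q = 1) {f : K[X]}
    (hf0 : f ≠ 0) {ξ : Fin n → K} (hξ : ∀ z, f.eval z = f.leadingCoeff * ∏ j, (z - ξ j))
    {τ : ℝ} (hτ : 0 ≤ τ) (hB : (1 + 2 * τ) * (1 + powBound n (aConst n q * τ)) < 2)
    {x : Fin n → K} (hx : Function.Injective x) {k : ℝ} (hk : 0 ≤ k) (hk' : k ≤ 1)
    (hE : errFun p x ξ ≤ k * τ) (m : ℕ) :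
    x ∈ iterDomain f (m + 1) ∧
      ∀ i, ‖iterMap f (m + 1) x i - ξ i‖ ≤
        powBound n (aConst n q * τ) * k ^ (m + 1) * ‖x i - ξ i‖ := by
  have ha0 : 0 ≤ aConst n q := zero_le_one.trans (one_le_aConst hn q)
  have haτ : 0 ≤ aConst n q * τ := mul_nonneg ha0 hτ
  have hB0 := powBound_nonneg n haτ
  set B := powBound n (aConst n q * τ) with hBdef
  set e : Fin n → ℝ := fun j => ‖x j - ξ j‖ / sep x j with he
  have he0 : ∀ j, 0 ≤ e j := fun j => div_nonneg (norm_nonneg _) (sep_nonneg x j)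
  have hsum : ∀ i, ∑ j ∈ Finset.univ.erase i, e j ≤ k * (aConst n q * τ) := fun i => by
    have := sum_erase_norm_le hp hpq e i
    simp only [Real.norm_of_nonneg (he0 _)] at this
    refine this.trans ((mul_le_mul_of_nonneg_left hE ha0).trans_eq (by ring))
  have hxe : ∀ i j, j ≠ i → ‖x j - ξ j‖ ≤ e j * ‖x i - x j‖ := fun i j hj => by
    rw [← div_mul_cancel₀ ‖x j - ξ j‖ (sep_pos hn hx j).ne', norm_sub_rev (x i)]
    exact mul_le_mul_of_nonneg_left (sep_le x hj.symm) (he0 j)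
  have hxτ : ∀ j, ‖x j - ξ j‖ ≤ τ * sep x j := fun j =>
    (norm_sub_le_errFun_mul_sep hn hp hx ξ j).trans
      (mul_le_mul_of_nonneg_right (hE.trans (mul_le_of_le_one_left hτ hk')) (sep_nonneg x j))
  induction m with
  | zero =>
    refine ⟨⟨Set.mem_univ x, fun i j hij h => hij (hx h)⟩, fun i => ?_⟩
    rw [zero_add, pow_one]
    exact norm_weierstrass_step_sub_le hn hf0 hξ (y := x) (v := e) (fun j hj h => hj (hx h).symm)
      hk hk' haτ he0 (hxe i) (hsum i)
  | succ m ih =>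
    have hkm : k ^ (m + 1) ≤ 1 := pow_le_one₀ hk hk'
    have hkm0 : 0 ≤ k ^ (m + 1) := pow_nonneg hk _
    have hdist : ∀ i j, j ≠ i →
        B * ‖x i - x j‖ ≤ ‖x i - iterMap f (m + 1) x j‖ ∧ x i ≠ iterMap f (m + 1) x j := by
      intro i j hj
      have h1 := (mul_norm_sub_le_of_norm_sub_le hxτ hτ (mul_nonneg hB0 hkm0)
        (mul_le_of_le_one_right hB0 hkm) ih.2 hj.symm).1
      have h2 : 0 < ‖x i - x j‖ := norm_pos_iff.2 (sub_ne_zero.2 fun h => hj (hx h).symm)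
      -- The distance bound `B * ‖x i - x j‖` cancels the `B` in the induction hypothesis, leaving
      -- the relative errors at `k ^ (m + 1) * e j`; their sum supplies one more `k`.
      have h3 : B < 1 - (1 + B) * τ := by nlinarith
      refine ⟨(mul_le_mul_of_nonneg_right h3.le h2.le).trans h1, sub_ne_zero.1 (norm_pos_iff.1 ?_)⟩
      exact (mul_pos (hB0.trans_lt h3) h2).trans_le h1
    refine ⟨⟨ih.1, fun i j hij => (hdist i j hij.symm).2⟩, fun i => ?_⟩
    refine norm_weierstrass_step_sub_le hn hf0 hξ (y := iterMap f (m + 1) x)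
      (v := fun j => k ^ (m + 1) * e j) (fun j hj => (hdist i j hj).2) (pow_nonneg hk _)
      (pow_le_one₀ hk hk') haτ (fun j => mul_nonneg hkm0 (he0 j)) (fun j hj => ?_) ?_
    · calc ‖iterMap f (m + 1) x j - ξ j‖ ≤ B * k ^ (m + 1) * (e j * ‖x i - x j‖) :=
            (ih.2 j).trans (mul_le_mul_of_nonneg_left (hxe i j hj) (mul_nonneg hB0 hkm0))
        _ = k ^ (m + 1) * e j * (B * ‖x i - x j‖) := by ring
        _ ≤ _ := mul_le_mul_of_nonneg_left (hdist i j hj).1 (mul_nonneg hkm0 (he0 j))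
    · rw [← Finset.mul_sum, pow_succ _ (m + 1), mul_assoc]
      exact mul_le_mul_of_nonneg_left (hsum i) hkm0

lemma injective_and_errFun_le (hn : 2 ≤ n) (hp : 1 ≤ p) {x y ξ : Fin n → K} {τ b B : ℝ}
    (hτ : 0 ≤ τ) (hB0 : 0 ≤ B) (hB : (1 + 2 * τ) * (1 + B) < 2) (hx : Function.Injective x)
    (hE : errFun p x ξ ≤ τ) (hb : 0 ≤ b) (hbB : b ≤ B)
    (hy : ∀ j, ‖y j - ξ j‖ ≤ b * ‖x j - ξ j‖) :
    Function.Injective y ∧ errFun p y ξ ≤ errFun p x ξ := by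
  have hxτ : ∀ j, ‖x j - ξ j‖ ≤ τ * sep x j := fun j =>
    (norm_sub_le_errFun_mul_sep hn hp hx ξ j).trans
      (mul_le_mul_of_nonneg_right hE (sep_nonneg x j))
  -- A rearrangement of `hB`: separations keep at least the factor `B` by which errors shrink, so
  -- their quotient does not grow.
  have hD : B < 1 - 2 * ((1 + B) * τ) := by nlinarith
  have hdist := fun i j (hij : i ≠ j) =>
    (mul_norm_sub_le_of_norm_sub_le hxτ hτ hb hbB hy hij).2
  have hyinj : Function.Injective y := by
    intro i j h
    by_contra hij
    have h2 : 0 < ‖x i - x j‖ := norm_pos_iff.2 (sub_ne_zero.2 fun h => hij (hx h))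
    have h3 := (mul_pos (hB0.trans_lt hD) h2).trans_le (hdist i j hij)
    simp [h] at h3
  refine ⟨hyinj, ?_⟩
  rw [← one_mul (errFun p x ξ)]
  refine pNorm_le_mul hp zero_le_one fun i => ?_
  rw [Real.norm_of_nonneg (div_nonneg (norm_nonneg _) (sep_nonneg y i)),
    Real.norm_of_nonneg (div_nonneg (norm_nonneg _) (sep_nonneg x i)), one_mul,
    div_le_div_iff₀ (sep_pos hn hyinj i) (sep_pos hn hx i)]
  have hsep : B * sep x i ≤ sep y i := le_sep hn fun j hj =>
    calc B * sep x i ≤ (1 - 2 * ((1 + B) * τ)) * ‖x i - x j‖ :=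
          mul_le_mul hD.le (sep_le x hj) (sep_nonneg x i) (hB0.trans hD.le)
      _ ≤ _ := hdist i j hj.symm
  calc ‖y i - ξ i‖ * sep x i ≤ (B * ‖x i - ξ i‖) * sep x i :=
        mul_le_mul_of_nonneg_right ((hy i).trans
          (mul_le_mul_of_nonneg_right hbB (norm_nonneg _))) (sep_nonneg x i)
    _ = ‖x i - ξ i‖ * (B * sep x i) := by ring
    _ ≤ _ := mul_le_mul_of_nonneg_left hsep (norm_nonneg _)

/-- Bounds the separations of all iterates below by that of `ξ`, making the constant in the order
estimate uniform. -/
lemma sep_le_mul_sep (hn : 2 ≤ n) (hp : 1 ≤ p) {x ξ : Fin n → K} {τ : ℝ} (hτ : 0 ≤ τ)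
    (hx : Function.Injective x) (hE : errFun p x ξ ≤ τ) (i : Fin n) :
    sep ξ i ≤ (1 + 2 * τ) * sep x i := by
  have hxτ : ∀ j, ‖x j - ξ j‖ ≤ τ * sep x j := fun j =>
    (norm_sub_le_errFun_mul_sep hn hp hx ξ j).trans
      (mul_le_mul_of_nonneg_right hE (sep_nonneg x j))
  rw [← div_le_iff₀' (by positivity)]
  refine le_sep hn fun j hj => ?_
  rw [div_le_iff₀' (by positivity)]
  have h1 := (hxτ i).trans (mul_le_mul_of_nonneg_left (sep_le x hj) hτ)
  have h2 := (hxτ j).trans (mul_le_mul_of_nonneg_left (sep_le x hj.symm) hτ)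
  have h3 := norm_sub_le_norm_sub_add_norm_sub (ξ i) (x i) (ξ j)
  have h4 := norm_sub_le_norm_sub_add_norm_sub (x i) (x j) (ξ j)
  rw [norm_sub_rev (ξ i) (x i)] at h3
  rw [norm_sub_rev (x j) (x i)] at h2
  linarith [sep_le ξ hj]

/-- Local convergence of the iteration `x (k + 1) = T^(N) (x k)`. -/
theorem convergesWithOrder_of_errFun_le (hn : 2 ≤ n) (hp : 1 ≤ p) (hpq : 1 / p + 1 / q = 1)
    {f : K[X]} (hf0 : f ≠ 0) {ξ : Fin n → K}
    (hξ : ∀ z, f.eval z = f.leadingCoeff * ∏ j, (z - ξ j)) (hξinj : Function.Injective ξ)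
    {τ : ℝ} (hτ : 0 ≤ τ) (hB : (1 + 2 * τ) * (1 + powBound n (aConst n q * τ)) < 2)
    {N : ℕ} (hN : 1 ≤ N) {x : ℕ → Fin n → K} (hx₀ : Function.Injective (x 0))
    (hE : errFun p (x 0) ξ ≤ τ) (hx : ∀ k, x (k + 1) = iterMap f N (x k)) :
    (∀ k, x k ∈ iterDomain f N ∧ Function.Injective (x k) ∧ errFun p (x k) ξ ≤ τ) ∧
      ConvergesWithOrder p x ξ (N + 1) := by
  obtain ⟨N, rfl⟩ : ∃ M, N = M + 1 := ⟨N - 1, by omega⟩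
  have ha0 : 0 ≤ aConst n q := zero_le_one.trans (one_le_aConst hn q)
  have haτ : 0 ≤ aConst n q * τ := mul_nonneg ha0 hτ
  have hB0 := powBound_nonneg n haτ
  have hstep := fun (y : Fin n → K) (hy : Function.Injective y) (k : ℝ) (hk : 0 ≤ k) (hk' : k ≤ 1)
    (h : errFun p y ξ ≤ k * τ) => iterMap_succ_bound hn hp hpq hf0 hξ hτ hB hy hk hk' h N
  set B := powBound n (aConst n q * τ)
  have hB1 : B < 1 := by nlinarith
  have hinv : ∀ k, Function.Injective (x k) ∧ errFun p (x k) ξ ≤ τ := by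
    intro k
    induction k with
    | zero => exact ⟨hx₀, hE⟩
    | succ k ih =>
      have h1 := (hstep (x k) ih.1 1 zero_le_one le_rfl (by rw [one_mul]; exact ih.2)).2
      rw [one_pow, mul_one, ← hx] at h1
      have h2 := injective_and_errFun_le hn hp hτ hB0 hB ih.1 ih.2 hB0 le_rfl h1
      exact ⟨h2.1, h2.2.trans ih.2⟩
  have hgeom : ∀ k i, ‖x k i - ξ i‖ ≤ B ^ k * ‖x 0 i - ξ i‖ := by
    intro k i
    induction k with
    | zero => simp
    | succ k ih =>
      have h1 := (hstep (x k) (hinv k).1 1 zero_le_one le_rfl (by rw [one_mul]; exact (hinv k).2)).2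
      rw [one_pow, mul_one, ← hx] at h1
      rw [pow_succ', mul_assoc]
      exact (h1 i).trans (mul_le_mul_of_nonneg_left ih hB0)
  refine ⟨fun k => ⟨(hstep (x k) (hinv k).1 1 zero_le_one le_rfl
    (by rw [one_mul]; exact (hinv k).2)).1, hinv k⟩, ?_, ?_⟩
  · refine tendsto_pi_nhds.2 fun i => tendsto_iff_norm_sub_tendsto_zero.2 ?_
    refine squeeze_zero (fun _ => norm_nonneg _) (fun k => hgeom k i) ?_
    simpa using (tendsto_pow_atTop_nhds_zero_of_lt_one hB0 hB1).mul_const ‖x 0 i - ξ i‖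
  · have hne : Nonempty (Fin n) := ⟨⟨0, by omega⟩⟩
    obtain ⟨i₀, hi₀⟩ := Finite.exists_min (sep ξ)
    set δ := sep ξ i₀ / (1 + 2 * τ) with hδ
    have hδ0 : 0 < δ := div_pos (sep_pos hn hξinj i₀) (by positivity)
    refine ⟨(1 / (δ * τ)) ^ (N + 1), fun k => ?_⟩
    have hEk := (hinv k).2
    have hE0 : 0 ≤ errFun p (x k) ξ := pNorm_nonneg hp _
    have hP0 : 0 ≤ pNorm p (x k - ξ) := pNorm_nonneg hp _
    have hEδ : errFun p (x k) ξ ≤ δ⁻¹ * pNorm p (x k - ξ) := by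
      refine pNorm_le_mul hp (by positivity) fun i => ?_
      rw [Real.norm_of_nonneg (div_nonneg (norm_nonneg _) (sep_nonneg _ i)), Pi.sub_apply,
        div_eq_inv_mul]
      have : δ ≤ sep (x k) i := by
        rw [hδ, div_le_iff₀' (by positivity)]
        exact (hi₀ i).trans (sep_le_mul_sep hn hp hτ (hinv k).1 hEk i)
      gcongr
    -- For `τ = 0` the error vanishes, and division by zero giving `0` does no harm.
    have hkτ : errFun p (x k) ξ ≤ errFun p (x k) ξ / τ * τ := by
      rcases hτ.eq_or_lt with h | h
      · rw [← h, mul_zero]; rwa [← h] at hEk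
      · rw [div_mul_cancel₀ _ h.ne']
    -- The smallest admissible `k` is now the current error over `τ`; its power `N + 1` with one
    -- plain error factor gives order `N + 2`, as `N` was shifted by one.
    have hκ := (hstep (x k) (hinv k).1 (errFun p (x k) ξ / τ) (by positivity)
      (div_le_one_of_le₀ hEk hτ) hkτ).2
    rw [← hx] at hκ
    calc pNorm p (x (k + 1) - ξ)
        ≤ B * (errFun p (x k) ξ / τ) ^ (N + 1) * pNorm p (x k - ξ) :=
          pNorm_le_mul hp (by positivity) hκ
      _ ≤ 1 * (1 / (δ * τ) * pNorm p (x k - ξ)) ^ (N + 1) * pNorm p (x k - ξ) := by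
          have : errFun p (x k) ξ / τ ≤ 1 / (δ * τ) * pNorm p (x k - ξ) := by
            calc errFun p (x k) ξ / τ ≤ δ⁻¹ * pNorm p (x k - ξ) / τ := by gcongr
              _ = _ := by rw [one_div, mul_inv]; ring
          gcongr
      _ = (1 / (δ * τ)) ^ (N + 1) * pNorm p (x k - ξ) ^ (N + 1 + 1) := by
          rw [one_mul, mul_pow, mul_assoc, ← pow_succ]

end LocalConvergence

/-! ### Matching zeros with components. -/

section Main

variable {K : Type*} [NormedField K] {n : ℕ}

/-- Radii below half the separations make the discs about the `x i` disjoint. -/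
lemma injective_of_norm_sub_le {x ξ : Fin n → K} {τ : ℝ} (hτ : 2 * τ < 1)
    (hx : Function.Injective x) (h : ∀ i, ‖x i - ξ i‖ ≤ τ * sep x i) : Function.Injective ξ := by
  intro i j hij
  by_contra hne
  have hd : 0 < ‖x i - x j‖ := norm_pos_iff.2 (sub_ne_zero.2 fun h => hne (hx h))
  have h3 := norm_sub_le_norm_sub_add_norm_sub (x i) (ξ i) (x j)
  have h1 := h i
  have h2 := h j
  rw [← hij, norm_sub_rev] at h2
  have h4 := sep_le x (Ne.symm hne)
  have h5 := sep_le x hne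
  rw [norm_sub_rev] at h5
  rcases le_or_gt 0 τ with h0 | h0 <;> nlinarith [sep_nonneg x i, sep_nonneg x j]

/-- The only component of `ξ` that is close to `x i` is `ξ i`. -/
lemma eq_of_norm_sub_le {x ξ : Fin n → K} {τ σ : ℝ} (hτ0 : 0 ≤ τ) (hτ : 2 * τ < 1) (hσ0 : 0 ≤ σ)
    (hσ : 2 * σ < 1) (hx : Function.Injective x) (h : ∀ i, ‖x i - ξ i‖ ≤ τ * sep x i)
    {i j : Fin n} (hij : ‖x i - ξ j‖ ≤ σ * sep x i) : j = i := by
  by_contra hne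
  have hd : 0 < ‖x i - x j‖ := norm_pos_iff.2 (sub_ne_zero.2 fun h => hne (hx h).symm)
  have h3 := norm_sub_le_norm_sub_add_norm_sub (x i) (ξ j) (x j)
  rw [norm_sub_rev (ξ j)] at h3
  have h4 := mul_le_mul_of_nonneg_left (sep_le x hne) hσ0
  have h5 := mul_le_mul_of_nonneg_left (sep_le x (Ne.symm hne)) hτ0
  rw [norm_sub_rev (x j) (x i)] at h5
  nlinarith [h j]

end Main

end WeierstrassType

open WeierstrassType

theorem mainTheorem4 {K : Type*} [NormedField K] [IsAlgClosed K]
    (n : ℕ) (hn : 2 ≤ n) (f : K[X]) (hf : f.natDegree = n)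
    (N : ℕ) (hN : 1 ≤ N) (p q : ℝ≥0∞) (hp : 1 ≤ p) (hpq : 1 / p + 1 / q = 1)
    (x₀ : Fin n → K) (hx₀ : Function.Injective x₀)
    (hE : WeierstrassType.initFun p f x₀ ≤
      1 / (1 + Real.sqrt (WeierstrassType.aConst n q)) ^ 2)
    (hΩ : WeierstrassType.Omega n p q (WeierstrassType.initFun p f x₀) < 2)
    (hstrict : n = 2 → p = ∞ → WeierstrassType.initFun p f x₀ <
      1 / (1 + Real.sqrt (WeierstrassType.aConst n q)) ^ 2)
    (x : ℕ → Fin n → K) (hx_zero : x 0 = x₀)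
    (hx_succ : ∀ k : ℕ, x (k + 1) = WeierstrassType.iterMap f N (x k)) :
    WeierstrassType.HasOnlySimpleZeros f ∧
    (∀ k : ℕ, x k ∈ WeierstrassType.iterDomain f N ∧ Function.Injective (x k)) ∧
    ∃ ξ : Fin n → K, WeierstrassType.IsRootVector f ξ ∧
      WeierstrassType.ConvergesWithOrder p x ξ (N + 1) ∧
      ∀ k : ℕ,
        WeierstrassType.initFun p f (x k) ≤
          1 / (1 + Real.sqrt (WeierstrassType.aConst n q)) ^ 2 →
        WeierstrassType.Omega n p q (WeierstrassType.initFun p f (x k)) < 2 →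
        ∀ i : Fin n, ‖x k i - ξ i‖ ≤
          WeierstrassType.alpha (WeierstrassType.aConst n q) (WeierstrassType.initFun p f (x k)) *
            ‖WeierstrassType.W f (x k) i‖ := by
  subst hx_zero
  have hf0 : f ≠ 0 := by
    rintro rfl
    rw [natDegree_zero] at hf
    omega
  have ha := one_le_aConst hn q
  have ht := initFun_nonneg hp f (x 0)
  have hα := (alpha_spec ha ht hE).1
  obtain ⟨hτ, hτ2, -⟩ := hFun_aConst_facts hn hpq ht hE hΩ
  choose ξ hroot hξ using exists_isRoot_of_initFun hn hp hpq hf hf0 hx₀ hE hΩ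
  have hξinj := injective_of_norm_sub_le hτ2 hx₀
    fun i => (hξ i).trans (alpha_mul_norm_W_le hn hp hx₀ hα i)
  have heval : ∀ z, f.eval z = f.leadingCoeff * ∏ j, (z - ξ j) := fun z => by
    conv_lhs => rw [eq_C_mul_prod_of_isRoot hf hf0 hξinj hroot]
    rw [eval_mul, eval_C, eval_prod_X_sub_C]
  have hB : (1 + 2 * hFun (aConst n q) (initFun p f (x 0))) *
      (1 + powBound n (aConst n q * hFun (aConst n q) (initFun p f (x 0)))) < 2 := by
    rwa [powBound, add_sub_cancel, ← Psi_eq hn hpq]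
  have herr : errFun p (x 0) ξ ≤ hFun (aConst n q) (initFun p f (x 0)) := by
    rw [hFun, mul_comm]
    refine pNorm_le_mul hp hα.le fun i => ?_
    rw [Real.norm_of_nonneg (div_nonneg (norm_nonneg _) (sep_nonneg _ i)),
      Real.norm_of_nonneg (div_nonneg (norm_nonneg _) (sep_nonneg _ i)), ← mul_div_assoc]
    exact div_le_div_of_nonneg_right (hξ i) (sep_nonneg _ i)
  obtain ⟨hwd, hconv⟩ := convergesWithOrder_of_errFun_le hn hp hpq hf0 heval hξinj hτ hB hN hx₀
    herr hx_succ
  refine ⟨hasOnlySimpleZeros_of_isRoot hf hf0 hξinj hroot, fun k => ⟨(hwd k).1, (hwd k).2.1⟩,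
    ξ, ⟨f.leadingCoeff, heval⟩, hconv, fun k hEk hΩk i => ?_⟩
  obtain ⟨-, hxk, hEξ⟩ := hwd k
  have htk := initFun_nonneg hp f (x k)
  have hαk := (alpha_spec ha htk hEk).1
  obtain ⟨hσ, hσ2, -⟩ := hFun_aConst_facts hn hpq htk hEk hΩk
  obtain ⟨ζ, hζ, hle⟩ := exists_isRoot_of_initFun hn hp hpq hf hf0 hxk hEk hΩk i
  -- The zero found from `x k` is some component of the `ξ` fixed at the start; closeness to `x k i`
  -- identifies its index.
  have hprod : ∏ j, (ζ - ξ j) = 0 :=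
    (mul_eq_zero.1 ((heval ζ).symm.trans hζ)).resolve_left (leadingCoeff_ne_zero.2 hf0)
  obtain ⟨j, -, hj⟩ := Finset.prod_eq_zero_iff.1 hprod
  rw [sub_eq_zero.1 hj] at hle
  have hji : j = i := eq_of_norm_sub_le hτ hτ2 hσ hσ2 hxk
    (fun i => (norm_sub_le_errFun_mul_sep hn hp hxk ξ i).trans
      (mul_le_mul_of_nonneg_right hEξ (sep_nonneg _ i)))
    (hle.trans (alpha_mul_norm_W_le hn hp hxk hαk i))
  rwa [hji] at hle
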